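/- Let $H$ be an infinite-dimensional separable complex Hilbert space (so $H\cong\ell^2$). Let $\mathcal K=S_2(H)$ be the Banach algebra of Hilbert–Schmidt operators on $H$, with composition as product and norm $\|T\|_2=\operatorname{Tr}(T^*T)^{1/2}$, and let $A=\mathcal K\otimes^\gamma\mathcal K$ be the completion of the algebraic tensor product $\mathcal K\otimes\mathcal K$ in the projective norm $\|u\|_\gamma=\inf\{\sum_i\|a_i\|_2\|b_i\|_2 : u=\sum_{i=1}^n a_i\otimes b_i\}$, a Banach algebra with $(a_1\otimes b_1)(a_2\otimes b_2)=a_1a_2\otimes b_1b_2$. Let $J:A\to A^{**}$ be the canonical embedding. For $a,b\in A$, $\omega\in A^*$ and $f,g\in A^{**}$ put $\omega_a(b)=\omega(ab)$, ${}_a\omega(b)=\omega(ba)$, ${}_g\omega(a)=g(\omega_a)$, $\omega_f(a)=f({}_a\omega)$, and define the two Arens products by $(f\,\Box\, g)(\omega)=f({}_g\omega)$ and $(f\diamond g)(\omega)=g(\omega_f)$. Let $$Z_t^{(l)}=\{\varphi\in A^{**}:\varphi\,\Box\,\psi=\varphi\diamond\psi\ \ \forall\psi\in A^{**}\},\qquad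 Z_t^{(r)}=\{\varphi\in A^{**}:\psi\,\Box\,\varphi=\psi\diamond\varphi\ \ \forall\psi\in A^{**}\}$$ be the left and right topological centres. The algebra $A$ is Arens regular if $\Box=\diamond$ on $A^{**}$, left (resp. right) strongly Arens irregular if $Z_t^{(l)}=J(A)$ (resp. $Z_t^{(r)}=J(A)$), and strongly Arens irregular if it is both. **Theorem.** The Banach algebra $A$ is not Arens regular, and it is not strongly Arens irregular; in fact it is neither left nor right strongly Arens irregular. More precisely, let $(e_n)_{n\in\mathbb N}$ be any orthonormal basis of $H$, let $e_{nn}\in\mathcal K$ be the rank-one operator $\xi\mapsto\langle\xi,e_n\rangle e_n$ (inner product linear in the first variable), and let $\mathcal U$ be any non-principal ultrafilter on $\mathbb N$. Then the sequence $J(e_{nn}\otimes e_{nn})$ converges along $\mathcal U$ in the weak* topology of $A^{**}$ to a unique element $\phi_{\mathcal U}\in A^{**}$, and $\phi_{\mathcal U}\notin J(A)$, while $$J(a)+\phi_{\mathcal U}\in Z_t^{(l)}\cap Z_t^{(r)}\qquad\text{for every }a\in A.$$ -/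

import Mathlib

open Filter Topology TensorProduct

noncomputable section

/-! ## Arens products on the bidual of a Banach algebra -/

namespace Arens

variable (𝕜 : Type*) [NontriviallyNormedField 𝕜]
variable (A : Type*) [NonUnitalNormedRing A] [NormedSpace 𝕜 A] [IsScalarTower 𝕜 A A]
  [SMulCommClass 𝕜 A A]

/-- The topological dual `A^*`. -/
abbrev Dual : Type _ := StrongDual 𝕜 A

/-- The topological bidual `A^{**}`. -/
abbrev Bidual : Type _ := StrongDual 𝕜 (StrongDual 𝕜 A)

/-- The canonical embedding `J : A → A^{**}`, `J a ω = ω a`. -/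
abbrev J : A →L[𝕜] Bidual 𝕜 A := NormedSpace.inclusionInDoubleDual 𝕜 A

/-- `(ω, a) ↦ ω_a = (L_a)^* ω`, that is `ω_a b = ω (a b)`. -/
def dualL : Dual 𝕜 A →L[𝕜] A →L[𝕜] Dual 𝕜 A :=
  ((ContinuousLinearMap.compL 𝕜 A (A →L[𝕜] A) (Dual 𝕜 A)).flip
    (ContinuousLinearMap.mul 𝕜 A)).comp (ContinuousLinearMap.compL 𝕜 A A 𝕜)

/-- `(ω, a) ↦ ₐω = (R_a)^* ω`, that is `ₐω b = ω (b a)`. -/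
def dualR : Dual 𝕜 A →L[𝕜] A →L[𝕜] Dual 𝕜 A :=
  ((ContinuousLinearMap.compL 𝕜 A (A →L[𝕜] A) (Dual 𝕜 A)).flip
    (ContinuousLinearMap.mul 𝕜 A).flip).comp (ContinuousLinearMap.compL 𝕜 A A 𝕜)

variable {𝕜 A}

@[simp] theorem dualL_apply (ω : Dual 𝕜 A) (a b : A) : dualL 𝕜 A ω a b = ω (a * b) := rfl

@[simp] theorem dualR_apply (ω : Dual 𝕜 A) (a b : A) : dualR 𝕜 A ω a b = ω (b * a) := rfl

/-- The first Arens product: `(f □ g) ω = f (_g ω)` where `_g ω a = g (ω_a)`. -/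
def box (f g : Bidual 𝕜 A) : Bidual 𝕜 A :=
  f.comp ((ContinuousLinearMap.compL 𝕜 A (Dual 𝕜 A) 𝕜 g).comp (dualL 𝕜 A))

/-- The second Arens product: `(f ⋄ g) ω = g (ω_f)` where `ω_f a = f (ₐω)`. -/
def diamond (f g : Bidual 𝕜 A) : Bidual 𝕜 A :=
  g.comp ((ContinuousLinearMap.compL 𝕜 A (Dual 𝕜 A) 𝕜 f).comp (dualR 𝕜 A))

theorem box_apply (f g : Bidual 𝕜 A) (ω : Dual 𝕜 A) :
    box f g ω = f (g.comp (dualL 𝕜 A ω)) := rfl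

theorem diamond_apply (f g : Bidual 𝕜 A) (ω : Dual 𝕜 A) :
    diamond f g ω = g (f.comp (dualR 𝕜 A ω)) := rfl

variable (𝕜 A)

/-- The left topological centre of `A^{**}`. -/
def leftTopologicalCenter : Set (Bidual 𝕜 A) := {φ | ∀ ψ : Bidual 𝕜 A, box φ ψ = diamond φ ψ}

/-- The right topological centre of `A^{**}`. -/
def rightTopologicalCenter : Set (Bidual 𝕜 A) := {φ | ∀ ψ : Bidual 𝕜 A, box ψ φ = diamond ψ φ}

/-- `A` is Arens regular if the two Arens products agree on `A^{**}`. -/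
def IsArensRegular : Prop := ∀ f g : Bidual 𝕜 A, box f g = diamond f g

/-- `A` is left strongly Arens irregular if its left topological centre is `A`. -/
def IsLeftStronglyArensIrregular : Prop := leftTopologicalCenter 𝕜 A = Set.range (J 𝕜 A)

/-- `A` is right strongly Arens irregular if its right topological centre is `A`. -/
def IsRightStronglyArensIrregular : Prop := rightTopologicalCenter 𝕜 A = Set.range (J 𝕜 A)

/-- `A` is strongly Arens irregular if it is so on the left and on the right. -/
def IsStronglyArensIrregular : Prop :=
  IsLeftStronglyArensIrregular 𝕜 A ∧ IsRightStronglyArensIrregular 𝕜 A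

end Arens

/-! ## The projective tensor product of two normed algebras -/

section Projective

variable (𝕜 : Type*) [NontriviallyNormedField 𝕜]
variable (A : Type*) [NonUnitalNormedRing A] [NormedSpace 𝕜 A] [IsScalarTower 𝕜 A A]
  [SMulCommClass 𝕜 A A]
variable (B : Type*) [NonUnitalNormedRing B] [NormedSpace 𝕜 B] [IsScalarTower 𝕜 B B]
  [SMulCommClass 𝕜 B B]

/-- The algebraic tensor product `A ⊗ B` with `(a₁ ⊗ b₁)(a₂ ⊗ b₂) = a₁a₂ ⊗ b₁b₂`; it will carry
the projective norm. -/
def AlgTensor : Type _ := A ⊗[𝕜] B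

namespace AlgTensor

instance : NonUnitalRing (AlgTensor 𝕜 A B) := inferInstanceAs (NonUnitalRing (A ⊗[𝕜] B))

instance : Module 𝕜 (AlgTensor 𝕜 A B) := inferInstanceAs (Module 𝕜 (A ⊗[𝕜] B))

instance : IsScalarTower 𝕜 (AlgTensor 𝕜 A B) (AlgTensor 𝕜 A B) :=
  inferInstanceAs (IsScalarTower 𝕜 (A ⊗[𝕜] B) (A ⊗[𝕜] B))

instance : SMulCommClass 𝕜 (AlgTensor 𝕜 A B) (AlgTensor 𝕜 A B) :=
  inferInstanceAs (SMulCommClass 𝕜 (A ⊗[𝕜] B) (A ⊗[𝕜] B))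

variable {A B} in
/-- The elementary tensor `a ⊗ b`. -/
def tmul (a : A) (b : B) : AlgTensor 𝕜 A B := a ⊗ₜ[𝕜] b

variable {A B}

theorem tmul_mul_tmul (a₁ a₂ : A) (b₁ b₂ : B) :
    tmul 𝕜 a₁ b₁ * tmul 𝕜 a₂ b₂ = tmul 𝕜 (a₁ * a₂) (b₁ * b₂) :=
  Algebra.TensorProduct.tmul_mul_tmul a₁ a₂ b₁ b₂

theorem smul_tmul (c : 𝕜) (a : A) (b : B) : c • tmul 𝕜 a b = tmul 𝕜 (c • a) b :=
  TensorProduct.smul_tmul' c a b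

variable {𝕜}

/-- The values `∑ ‖aᵢ‖ ‖bᵢ‖` over all finite representations `u = ∑ aᵢ ⊗ bᵢ`. -/
def repValues (u : AlgTensor 𝕜 A B) : Set ℝ :=
  {r | ∃ (n : ℕ) (a : Fin n → A) (b : Fin n → B),
    u = ∑ i, tmul 𝕜 (a i) (b i) ∧ r = ∑ i, ‖a i‖ * ‖b i‖}

/-- The projective norm. -/
instance : Norm (AlgTensor 𝕜 A B) := ⟨fun u => sInf (repValues u)⟩

theorem norm_def (u : AlgTensor 𝕜 A B) : ‖u‖ = sInf (repValues u) := rfl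

theorem nonneg_of_mem {u : AlgTensor 𝕜 A B} {r : ℝ} (h : r ∈ repValues u) : 0 ≤ r := by
  obtain ⟨n, a, b, -, rfl⟩ := h
  positivity

theorem bddBelow_repValues (u : AlgTensor 𝕜 A B) : BddBelow (repValues u) :=
  ⟨0, fun _ h => nonneg_of_mem h⟩

theorem tmul_mem (a : A) (b : B) : ‖a‖ * ‖b‖ ∈ repValues (tmul 𝕜 a b) :=
  ⟨1, fun _ => a, fun _ => b, by simp, by simp⟩

theorem add_mem {u v : AlgTensor 𝕜 A B} {r s : ℝ} (hr : r ∈ repValues u) (hs : s ∈ repValues v) :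
    r + s ∈ repValues (u + v) := by
  obtain ⟨n, a, b, rfl, rfl⟩ := hr
  obtain ⟨m, c, d, rfl, rfl⟩ := hs
  exact ⟨n + m, Fin.append a c, Fin.append b d, by simp [Fin.sum_univ_add],
    by simp [Fin.sum_univ_add]⟩

theorem smul_mem (c : 𝕜) {u : AlgTensor 𝕜 A B} {r : ℝ} (hr : r ∈ repValues u) :
    ‖c‖ * r ∈ repValues (c • u) := by
  obtain ⟨n, a, b, rfl, rfl⟩ := hr
  exact ⟨n, fun i => c • a i, b, by simp [Finset.smul_sum, smul_tmul],
    by simp [Finset.mul_sum, norm_smul, mul_assoc]⟩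

theorem zero_mem : (0 : ℝ) ∈ repValues (0 : AlgTensor 𝕜 A B) :=
  ⟨0, fun _ => 0, fun _ => 0, by simp, by simp⟩

theorem nonempty_repValues (u : AlgTensor 𝕜 A B) : (repValues u).Nonempty := by
  refine TensorProduct.induction_on (motive := fun u => (repValues (𝕜 := 𝕜) u).Nonempty) u
    ⟨0, zero_mem⟩ (fun a b => ⟨_, tmul_mem a b⟩) ?_
  rintro u v ⟨r, hr⟩ ⟨s, hs⟩
  exact ⟨r + s, add_mem hr hs⟩

theorem norm_le_of_mem {u : AlgTensor 𝕜 A B} {r : ℝ} (h : r ∈ repValues u) : ‖u‖ ≤ r :=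
  csInf_le (bddBelow_repValues u) h

theorem exists_mem_lt (u : AlgTensor 𝕜 A B) {ε : ℝ} (hε : 0 < ε) :
    ∃ r ∈ repValues u, r < ‖u‖ + ε :=
  exists_lt_of_csInf_lt (nonempty_repValues u) (lt_add_of_pos_right _ hε)

theorem norm_nonneg' (u : AlgTensor 𝕜 A B) : 0 ≤ ‖u‖ :=
  le_csInf (nonempty_repValues u) fun _ h => nonneg_of_mem h

theorem norm_zero' : ‖(0 : AlgTensor 𝕜 A B)‖ = 0 :=
  le_antisymm (norm_le_of_mem zero_mem) (norm_nonneg' _)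

theorem norm_add_le' (u v : AlgTensor 𝕜 A B) : ‖u + v‖ ≤ ‖u‖ + ‖v‖ := by
  refine le_of_forall_pos_le_add fun ε hε => ?_
  obtain ⟨r, hr, hr'⟩ := exists_mem_lt u (half_pos hε)
  obtain ⟨s, hs, hs'⟩ := exists_mem_lt v (half_pos hε)
  linarith [norm_le_of_mem (add_mem hr hs)]

theorem norm_smul_le' (c : 𝕜) (u : AlgTensor 𝕜 A B) : ‖c • u‖ ≤ ‖c‖ * ‖u‖ := by
  rw [norm_def u, ← smul_eq_mul, ← Real.sInf_smul_of_nonneg (norm_nonneg c)]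
  refine le_csInf ((nonempty_repValues u).image _) ?_
  rintro _ ⟨r, hr, rfl⟩
  exact norm_le_of_mem (smul_mem c hr)

/-- The projective norm as a seminorm. -/
def projSeminorm : Seminorm 𝕜 (AlgTensor 𝕜 A B) :=
  Seminorm.ofSMulLE (fun u => ‖u‖) norm_zero' norm_add_le' norm_smul_le'

instance : SeminormedAddCommGroup (AlgTensor 𝕜 A B) :=
  (projSeminorm (𝕜 := 𝕜) (A := A) (B := B)).toAddGroupSeminorm.toSeminormedAddCommGroup

instance : NormedSpace 𝕜 (AlgTensor 𝕜 A B) where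
  norm_smul_le := norm_smul_le'

theorem norm_tmul_le (a : A) (b : B) : ‖tmul 𝕜 a b‖ ≤ ‖a‖ * ‖b‖ := norm_le_of_mem (tmul_mem a b)

theorem mul_mem {u v : AlgTensor 𝕜 A B} {r s : ℝ} (hr : r ∈ repValues u) (hs : s ∈ repValues v) :
    ‖u * v‖ ≤ r * s := by
  obtain ⟨n, a, b, rfl, rfl⟩ := hr
  obtain ⟨m, c, d, rfl, rfl⟩ := hs
  rw [Finset.sum_mul_sum, Finset.sum_mul_sum]
  refine (norm_sum_le _ _).trans (Finset.sum_le_sum fun i _ => ?_)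
  refine (norm_sum_le _ _).trans (Finset.sum_le_sum fun j _ => ?_)
  rw [tmul_mul_tmul]
  calc ‖tmul 𝕜 (a i * c j) (b i * d j)‖ ≤ ‖a i * c j‖ * ‖b i * d j‖ := norm_tmul_le _ _
    _ ≤ (‖a i‖ * ‖c j‖) * (‖b i‖ * ‖d j‖) := by gcongr <;> exact norm_mul_le _ _
    _ = _ := by ring

theorem norm_mul_le' (u v : AlgTensor 𝕜 A B) : ‖u * v‖ ≤ ‖u‖ * ‖v‖ := by
  have h : ∀ ε : ℝ, 0 < ε → ‖u * v‖ ≤ (‖u‖ + ε) * (‖v‖ + ε) := fun ε hε => by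
    obtain ⟨r, hr, hr'⟩ := exists_mem_lt u hε
    obtain ⟨s, hs, hs'⟩ := exists_mem_lt v hε
    refine (mul_mem hr hs).trans ?_
    gcongr
    exact nonneg_of_mem hs
  have hc : Tendsto (fun ε : ℝ => (‖u‖ + ε) * (‖v‖ + ε)) (𝓝[>] 0) (𝓝 ((‖u‖ + 0) * (‖v‖ + 0))) :=
    ((by fun_prop : Continuous fun ε : ℝ => (‖u‖ + ε) * (‖v‖ + ε)).tendsto 0).mono_left
      nhdsWithin_le_nhds
  simpa using ge_of_tendsto hc (eventually_nhdsWithin_of_forall h)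

instance : NonUnitalSeminormedRing (AlgTensor 𝕜 A B) where
  __ := (inferInstance : SeminormedAddCommGroup (AlgTensor 𝕜 A B))
  __ := (inferInstance : NonUnitalRing (AlgTensor 𝕜 A B))
  norm_mul_le := norm_mul_le'

end AlgTensor

/-- The projective tensor product `A ⊗^γ B`: the completion of `A ⊗ B` in the projective norm. -/
def ProjTensor : Type _ := UniformSpace.Completion (AlgTensor 𝕜 A B)

namespace ProjTensor

open UniformSpace

instance : NormedAddCommGroup (ProjTensor 𝕜 A B) :=
  inferInstanceAs (NormedAddCommGroup (Completion (AlgTensor 𝕜 A B)))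

instance : NormedSpace 𝕜 (ProjTensor 𝕜 A B) :=
  inferInstanceAs (NormedSpace 𝕜 (Completion (AlgTensor 𝕜 A B)))

instance : CompleteSpace (ProjTensor 𝕜 A B) :=
  inferInstanceAs (CompleteSpace (Completion (AlgTensor 𝕜 A B)))

variable {A B}

/-- The canonical map `A ⊗ B → A ⊗^γ B`. -/
def ofAlg : AlgTensor 𝕜 A B →L[𝕜] ProjTensor 𝕜 A B :=
  (Completion.toComplL : AlgTensor 𝕜 A B →L[𝕜] Completion (AlgTensor 𝕜 A B))

/-- The elementary tensor `a ⊗ b` in `A ⊗^γ B`. -/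
def tmul (a : A) (b : B) : ProjTensor 𝕜 A B := ofAlg 𝕜 (AlgTensor.tmul 𝕜 a b)

theorem norm_ofAlg (u : AlgTensor 𝕜 A B) : ‖ofAlg 𝕜 u‖ = ‖u‖ := Completion.norm_coe u

theorem isDenseInducing_ofAlg : IsDenseInducing (ofAlg 𝕜 : AlgTensor 𝕜 A B → ProjTensor 𝕜 A B) :=
  Completion.isDenseInducing_coe

/-- The multiplication of `A ⊗^γ B` is the continuous extension of that of `A ⊗ B`. -/
instance : Mul (ProjTensor 𝕜 A B) :=
  ⟨Function.curry <| ((isDenseInducing_ofAlg 𝕜).prodMap (isDenseInducing_ofAlg 𝕜)).extend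
    fun p : AlgTensor 𝕜 A B × AlgTensor 𝕜 A B => ofAlg 𝕜 (p.1 * p.2)⟩

theorem ofAlg_mul (u v : AlgTensor 𝕜 A B) : ofAlg 𝕜 (u * v) = ofAlg 𝕜 u * ofAlg 𝕜 v :=
  (((isDenseInducing_ofAlg 𝕜).prodMap (isDenseInducing_ofAlg 𝕜)).extend_eq
    ((ofAlg 𝕜).continuous.comp continuous_mul) (u, v)).symm

theorem tmul_mul_tmul (a₁ a₂ : A) (b₁ b₂ : B) :
    tmul 𝕜 a₁ b₁ * tmul 𝕜 a₂ b₂ = tmul 𝕜 (a₁ * a₂) (b₁ * b₂) := by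
  simp only [tmul, ← ofAlg_mul, AlgTensor.tmul_mul_tmul]

theorem continuous_mul' : Continuous fun p : ProjTensor 𝕜 A B × ProjTensor 𝕜 A B => p.1 * p.2 := by
  let m : AlgTensor 𝕜 A B →+ AlgTensor 𝕜 A B →+ ProjTensor 𝕜 A B :=
    (AddMonoidHom.mul : AlgTensor 𝕜 A B →+ AlgTensor 𝕜 A B →+ AlgTensor 𝕜 A B).compr₂
      (ofAlg 𝕜 : AlgTensor 𝕜 A B →L[𝕜] ProjTensor 𝕜 A B).toLinearMap.toAddMonoidHom
  have hm : Continuous fun p : AlgTensor 𝕜 A B × AlgTensor 𝕜 A B => m p.1 p.2 :=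
    (ofAlg 𝕜).continuous.comp continuous_mul
  let e : AlgTensor 𝕜 A B →+ ProjTensor 𝕜 A B :=
    (ofAlg 𝕜 : AlgTensor 𝕜 A B →L[𝕜] ProjTensor 𝕜 A B).toLinearMap.toAddMonoidHom
  have di : IsDenseInducing e := isDenseInducing_ofAlg 𝕜
  exact (di.extend_Z_bilin di hm :)

instance : ContinuousMul (ProjTensor 𝕜 A B) := ⟨continuous_mul' 𝕜⟩

variable {𝕜}

theorem induction_on₁ {p : ProjTensor 𝕜 A B → Prop} (x : ProjTensor 𝕜 A B)
    (hp : IsClosed {x | p x}) (h : ∀ u, p (ofAlg 𝕜 u)) : p x :=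
  Completion.induction_on x hp h

theorem induction_on₂ {p : ProjTensor 𝕜 A B → ProjTensor 𝕜 A B → Prop} (x y : ProjTensor 𝕜 A B)
    (hp : IsClosed {x : ProjTensor 𝕜 A B × ProjTensor 𝕜 A B | p x.1 x.2})
    (h : ∀ u v, p (ofAlg 𝕜 u) (ofAlg 𝕜 v)) : p x y :=
  Completion.induction_on₂ x y hp h

theorem induction_on₃ {p : ProjTensor 𝕜 A B → ProjTensor 𝕜 A B → ProjTensor 𝕜 A B → Prop}
    (x y z : ProjTensor 𝕜 A B)
    (hp : IsClosed {x : ProjTensor 𝕜 A B × ProjTensor 𝕜 A B × ProjTensor 𝕜 A B |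
      p x.1 x.2.1 x.2.2})
    (h : ∀ u v w, p (ofAlg 𝕜 u) (ofAlg 𝕜 v) (ofAlg 𝕜 w)) : p x y z :=
  Completion.induction_on₃ x y z hp h

instance : NonUnitalRing (ProjTensor 𝕜 A B) where
  __ := (inferInstance : AddCommGroup (ProjTensor 𝕜 A B))
  __ := (inferInstance : Mul (ProjTensor 𝕜 A B))
  zero_mul x := induction_on₁ (p := fun x => 0 * x = 0) x
    (isClosed_eq (by fun_prop) continuous_const) fun u => by
      rw [← map_zero (ofAlg 𝕜), ← ofAlg_mul, zero_mul]
  mul_zero x := induction_on₁ (p := fun x => x * 0 = 0) x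
    (isClosed_eq (by fun_prop) continuous_const) fun u => by
      rw [← map_zero (ofAlg 𝕜), ← ofAlg_mul, mul_zero]
  mul_assoc x y z := induction_on₃ (p := fun x y z => x * y * z = x * (y * z)) x y z
    (isClosed_eq (by fun_prop) (by fun_prop)) fun u v w => by
      simp only [← ofAlg_mul, mul_assoc]
  left_distrib x y z := induction_on₃ (p := fun x y z => x * (y + z) = x * y + x * z) x y z
    (isClosed_eq (by fun_prop) (by fun_prop)) fun u v w => by
      simp only [← ofAlg_mul, ← map_add, mul_add]
  right_distrib x y z := induction_on₃ (p := fun x y z => (x + y) * z = x * z + y * z) x y z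
    (isClosed_eq (by fun_prop) (by fun_prop)) fun u v w => by
      simp only [← ofAlg_mul, ← map_add, add_mul]

instance : NonUnitalNormedRing (ProjTensor 𝕜 A B) where
  __ := (inferInstance : NormedAddCommGroup (ProjTensor 𝕜 A B))
  __ := (inferInstance : NonUnitalRing (ProjTensor 𝕜 A B))
  norm_mul_le x y := induction_on₂ (p := fun x y => ‖x * y‖ ≤ ‖x‖ * ‖y‖) x y
    (isClosed_le (by fun_prop) (by fun_prop)) fun u v => by
      rw [← ofAlg_mul, norm_ofAlg, norm_ofAlg, norm_ofAlg]; exact norm_mul_le u v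

theorem smul_mul' (c : 𝕜) (x y : ProjTensor 𝕜 A B) : (c • x) * y = c • (x * y) :=
  induction_on₂ (p := fun x y => (c • x) * y = c • (x * y)) x y
    (isClosed_eq ((continuous_fst.const_smul c).mul continuous_snd)
      ((continuous_fst.mul continuous_snd).const_smul c)) fun u v => by
      rw [← map_smul (ofAlg 𝕜), ← ofAlg_mul, ← ofAlg_mul, ← map_smul (ofAlg 𝕜), smul_mul_assoc]

theorem mul_smul' (c : 𝕜) (x y : ProjTensor 𝕜 A B) : x * (c • y) = c • (x * y) :=
  induction_on₂ (p := fun x y => x * (c • y) = c • (x * y)) x y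
    (isClosed_eq (continuous_fst.mul (continuous_snd.const_smul c))
      ((continuous_fst.mul continuous_snd).const_smul c)) fun u v => by
      rw [← map_smul (ofAlg 𝕜), ← ofAlg_mul, ← ofAlg_mul, ← map_smul (ofAlg 𝕜), mul_smul_comm]

instance : IsScalarTower 𝕜 (ProjTensor 𝕜 A B) (ProjTensor 𝕜 A B) := ⟨smul_mul'⟩

instance : SMulCommClass 𝕜 (ProjTensor 𝕜 A B) (ProjTensor 𝕜 A B) :=
  ⟨fun c x y => (mul_smul' c x y).symm⟩

end ProjTensor

end Projective

/-! ## Hilbert–Schmidt operators -/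

section HilbertSchmidt

variable (H : Type*) [NormedAddCommGroup H] [InnerProductSpace ℂ H] [CompleteSpace H]

/-- A chosen orthonormal basis of `H`; nothing below depends on the choice, by
`HilbertSchmidt.mem_iff` and `HilbertSchmidt.hasSum_norm_sq`. -/
def hsIndex : Set H := (exists_hilbertBasis ℂ H).choose

/-- A chosen orthonormal basis of `H`. -/
def hsBasis : HilbertBasis (hsIndex H) ℂ H := (exists_hilbertBasis ℂ H).choose_spec.choose

theorem hs_memℓp_iff {E ι : Type*} [NormedAddCommGroup E] (f : ι → E) : Memℓp f 2 ↔ Summable fun i => ‖f i‖ ^ 2 := by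
  rw [memℓp_gen_iff (by simp)]
  simp

/-- The algebra of Hilbert–Schmidt operators: bounded `T` with `Tr (T^* T) = ∑ ‖T eᵢ‖² < ∞`. -/
def hsSubalgebra : NonUnitalSubalgebra ℂ (H →L[ℂ] H) where
  carrier := {T | Summable fun i => ‖T (hsBasis H i)‖ ^ 2}
  zero_mem' := by simp
  add_mem' {S T} hS hT := by
    have := ((hs_memℓp_iff _).2 hS).add ((hs_memℓp_iff _).2 hT)
    exact (hs_memℓp_iff _).1 this
  smul_mem' c T hT := by
    have := ((hs_memℓp_iff _).2 hT).const_smul c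
    exact (hs_memℓp_iff _).1 this
  mul_mem' {S T} hS hT := by
    refine Summable.of_nonneg_of_le (fun _ => by positivity) (fun i => ?_)
      (hT.mul_left (‖S‖ ^ 2))
    rw [← mul_pow]
    gcongr
    exact S.le_opNorm _

/-- The Banach algebra `S₂(H)` of Hilbert–Schmidt operators under composition, with the
Hilbert–Schmidt norm. -/
def HilbertSchmidt : Type _ := hsSubalgebra H

namespace HilbertSchmidt

variable {H}

instance : NonUnitalRing (HilbertSchmidt H) := inferInstanceAs (NonUnitalRing (hsSubalgebra H))

instance : Module ℂ (HilbertSchmidt H) := inferInstanceAs (Module ℂ (hsSubalgebra H))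

instance : IsScalarTower ℂ (HilbertSchmidt H) (HilbertSchmidt H) :=
  inferInstanceAs (IsScalarTower ℂ (hsSubalgebra H) (hsSubalgebra H))

instance : SMulCommClass ℂ (HilbertSchmidt H) (HilbertSchmidt H) :=
  inferInstanceAs (SMulCommClass ℂ (hsSubalgebra H) (hsSubalgebra H))

/-- The operator underlying an element of `S₂(H)`. -/
def toOp : HilbertSchmidt H →ₗ[ℂ] H →L[ℂ] H :=
  (NonUnitalSubalgebra.toSubmodule (hsSubalgebra H)).subtype

theorem toOp_injective : Function.Injective (toOp : HilbertSchmidt H → H →L[ℂ] H) :=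
  Subtype.val_injective

theorem toOp_mul (S T : HilbertSchmidt H) : toOp (S * T) = toOp S * toOp T := rfl

theorem summable_sq (T : HilbertSchmidt H) : Summable fun i => ‖toOp T (hsBasis H i)‖ ^ 2 := T.2

/-- The Hilbert–Schmidt norm `Tr (T^* T)^{1/2}`. -/
instance : Norm (HilbertSchmidt H) := ⟨fun T => √(∑' i, ‖toOp T (hsBasis H i)‖ ^ 2)⟩

theorem norm_def (T : HilbertSchmidt H) : ‖T‖ = √(∑' i, ‖toOp T (hsBasis H i)‖ ^ 2) := rfl

/-- The columns of `T`, as a square-summable family. -/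
def columns : HilbertSchmidt H →ₗ[ℂ] lp (fun _ : hsIndex H => H) 2 where
  toFun T := ⟨fun i => toOp T (hsBasis H i), (hs_memℓp_iff _).2 (summable_sq T)⟩
  map_add' _ _ := rfl
  map_smul' _ _ := rfl

theorem norm_columns (T : HilbertSchmidt H) : ‖columns T‖ = ‖T‖ := by
  rw [lp.norm_eq_tsum_rpow (by simp), norm_def, Real.sqrt_eq_rpow]
  simp only [ENNReal.toReal_ofNat, Real.rpow_ofNat]
  rfl

theorem ext_basis {ι : Type*} (c : HilbertBasis ι ℂ H) {S T : H →L[ℂ] H}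
    (h : ∀ i, S (c i) = T (c i)) : S = T := by
  refine ContinuousLinearMap.ext_on (s := Set.range c)
    (Submodule.dense_iff_topologicalClosure_eq_top.2 c.dense_span) ?_
  rintro _ ⟨i, rfl⟩
  exact h i

theorem columns_injective : Function.Injective (columns : HilbertSchmidt H → _) := fun _ _ h =>
  toOp_injective (ext_basis (hsBasis H) fun i => congrFun (congrArg Subtype.val h) i)

theorem normCore : NormedSpace.Core ℂ (HilbertSchmidt H) where
  norm_nonneg T := Real.sqrt_nonneg _
  norm_smul c T := by simp only [← norm_columns, map_smul, norm_smul]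
  norm_triangle S T := by simp only [← norm_columns, map_add]; exact norm_add_le _ _
  norm_eq_zero_iff T := by
    rw [← norm_columns, norm_eq_zero, map_eq_zero_iff _ columns_injective]

instance : NormedAddCommGroup (HilbertSchmidt H) := NormedAddCommGroup.ofCore normCore

instance : NormedSpace ℂ (HilbertSchmidt H) where
  norm_smul_le c T := (normCore.norm_smul c T).le

theorem parseval {ι : Type*} (b : HilbertBasis ι ℂ H) (x : H) :
    HasSum (fun i => ‖inner ℂ (b i) x‖ ^ 2) (‖x‖ ^ 2) := by
  have h := lp.hasSum_norm (p := 2) (by simp) (b.repr x)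
  simpa [b.repr_apply_apply] using h

theorem summable_sq_iff {E ι : Type*} [NormedAddCommGroup E] (g : ι → E) :
    (Summable fun i => ‖g i‖ ^ 2) ↔ ∑' i, ‖g i‖ₑ ^ 2 ≠ ⊤ := by
  have h : ∀ i, ‖g i‖ₑ ^ 2 = ((‖g i‖₊ ^ 2 : NNReal) : ENNReal) := fun i => by
    simp [enorm_eq_nnnorm]
  simp_rw [h]
  rw [ENNReal.tsum_coe_ne_top_iff_summable, ← NNReal.summable_coe]
  simp

theorem ofReal_tsum_sq {E ι : Type*} [NormedAddCommGroup E] (g : ι → E)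
    (hg : Summable fun i => ‖g i‖ ^ 2) :
    ENNReal.ofReal (∑' i, ‖g i‖ ^ 2) = ∑' i, ‖g i‖ₑ ^ 2 := by
  rw [ENNReal.ofReal_tsum_of_nonneg (fun _ => by positivity) hg]
  simp [ENNReal.ofReal_pow]

theorem parseval_enorm {ι : Type*} (b : HilbertBasis ι ℂ H) (x : H) :
    ∑' i, ‖inner ℂ (b i) x‖ₑ ^ 2 = ‖x‖ₑ ^ 2 := by
  rw [← ofReal_tsum_sq _ (parseval b x).summable, (parseval b x).tsum_eq]
  simp [ENNReal.ofReal_pow]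

/-- Square-sums of an operator and of its adjoint agree, in any two orthonormal bases. -/
theorem tsum_enorm_sq_adjoint {ι κ : Type*} (b : HilbertBasis ι ℂ H) (c : HilbertBasis κ ℂ H)
    (T : H →L[ℂ] H) :
    ∑' i, ‖T (b i)‖ₑ ^ 2 = ∑' j, ‖ContinuousLinearMap.adjoint T (c j)‖ₑ ^ 2 := by
  simp_rw [← parseval_enorm c (T _), ← parseval_enorm b (ContinuousLinearMap.adjoint T _)]
  rw [ENNReal.tsum_comm]
  refine tsum_congr fun j => tsum_congr fun i => ?_
  rw [ContinuousLinearMap.adjoint_inner_right, ← inner_conj_symm, RCLike.enorm_conj]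

/-- Being Hilbert–Schmidt can be tested in any orthonormal basis. -/
theorem mem_iff {ι : Type*} (c : HilbertBasis ι ℂ H) (T : H →L[ℂ] H) :
    T ∈ hsSubalgebra H ↔ Summable fun i => ‖T (c i)‖ ^ 2 := by
  change (Summable fun i => ‖T (hsBasis H i)‖ ^ 2) ↔ _
  rw [summable_sq_iff, summable_sq_iff, tsum_enorm_sq_adjoint _ c, tsum_enorm_sq_adjoint c c,
    ContinuousLinearMap.adjoint_adjoint]

theorem norm_sq (T : HilbertSchmidt H) : ‖T‖ ^ 2 = ∑' i, ‖toOp T (hsBasis H i)‖ ^ 2 :=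
  Real.sq_sqrt (tsum_nonneg fun _ => by positivity)

theorem enorm_sq {ι : Type*} (c : HilbertBasis ι ℂ H) (T : HilbertSchmidt H) :
    ENNReal.ofReal (‖T‖ ^ 2) = ∑' i, ‖toOp T (c i)‖ₑ ^ 2 := by
  rw [norm_sq, ofReal_tsum_sq _ (summable_sq T), tsum_enorm_sq_adjoint _ c,
    tsum_enorm_sq_adjoint c c, ContinuousLinearMap.adjoint_adjoint]

/-- The Hilbert–Schmidt norm can be computed in any orthonormal basis. -/
theorem hasSum_norm_sq {ι : Type*} (c : HilbertBasis ι ℂ H) (T : HilbertSchmidt H) :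
    HasSum (fun i => ‖toOp T (c i)‖ ^ 2) (‖T‖ ^ 2) := by
  have hs : Summable fun i => ‖toOp T (c i)‖ ^ 2 := (mem_iff c _).1 T.2
  have h := enorm_sq c T
  rw [← ofReal_tsum_sq _ hs, ENNReal.ofReal_eq_ofReal_iff (by positivity)
    (tsum_nonneg fun _ => by positivity)] at h
  rw [h]
  exact hs.hasSum

theorem norm_toOp_le (T : HilbertSchmidt H) : ‖toOp T‖ ≤ ‖T‖ := by
  refine ContinuousLinearMap.opNorm_le_bound _ (norm_nonneg _) fun x => ?_
  have h : ‖toOp T x‖ₑ ^ 2 ≤ ENNReal.ofReal (‖T‖ ^ 2) * ‖x‖ₑ ^ 2 := by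
    rw [enorm_sq (hsBasis H), tsum_enorm_sq_adjoint _ (hsBasis H), ← ENNReal.tsum_mul_right,
      ← parseval_enorm (hsBasis H) (toOp T x)]
    refine ENNReal.tsum_le_tsum fun j => ?_
    rw [← ContinuousLinearMap.adjoint_inner_left, ← mul_pow]
    gcongr
    rw [← ofReal_norm, ← ofReal_norm, ← ofReal_norm, ← ENNReal.ofReal_mul (norm_nonneg _)]
    exact ENNReal.ofReal_le_ofReal (norm_inner_le_norm _ _)
  rw [← ofReal_norm, ← ofReal_norm, ← ENNReal.ofReal_pow (norm_nonneg _),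
    ← ENNReal.ofReal_pow (norm_nonneg _), ← ENNReal.ofReal_mul (by positivity),
    ENNReal.ofReal_le_ofReal_iff (by positivity), ← mul_pow] at h
  exact le_of_sq_le_sq h (by positivity)

theorem norm_mul_le' (S T : HilbertSchmidt H) : ‖S * T‖ ≤ ‖S‖ * ‖T‖ := by
  refine le_of_sq_le_sq ?_ (by positivity)
  rw [mul_pow]
  refine hasSum_le (fun i => ?_) (hasSum_norm_sq (hsBasis H) (S * T))
    ((hasSum_norm_sq (hsBasis H) T).mul_left (‖S‖ ^ 2))
  rw [← mul_pow]
  refine pow_le_pow_left₀ (norm_nonneg _) ?_ 2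
  exact ((toOp S).le_opNorm _).trans (mul_le_mul_of_nonneg_right (norm_toOp_le S) (norm_nonneg _))

instance : NonUnitalNormedRing (HilbertSchmidt H) where
  __ := (inferInstance : NormedAddCommGroup (HilbertSchmidt H))
  __ := (inferInstance : NonUnitalRing (HilbertSchmidt H))
  norm_mul_le := norm_mul_le'

/-- The rank one operator `x ⊗ y : ξ ↦ ⟨ξ, y⟩ x` (inner product linear in `ξ`). -/
def rankOne (x y : H) : HilbertSchmidt H :=
  ⟨InnerProductSpace.rankOne ℂ x y, by
    refine ((parseval (hsBasis H) y).summable.mul_right (‖x‖ ^ 2)).congr fun i => ?_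
    rw [InnerProductSpace.rankOne_apply, norm_smul, mul_pow, norm_inner_symm]⟩

theorem toOp_rankOne (x y ξ : H) : toOp (rankOne x y) ξ = inner ℂ y ξ • x := rfl

end HilbertSchmidt

/-- The Banach algebra `A = S₂(H) ⊗^γ S₂(H)`. -/
abbrev HSTensor (H : Type*) [NormedAddCommGroup H] [InnerProductSpace ℂ H] [CompleteSpace H] :
    Type _ :=
  ProjTensor ℂ (HilbertSchmidt H) (HilbertSchmidt H)

/-- `φ = φ_U`: the weak* limit in `A^{**}`, along the ultrafilter `U`, of the sequence
`J (e_nn ⊗ e_nn)`, where `A = HSTensor H` and `e_nn = e_n ⊗ e_n` is the rank one operator. -/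
def IsUltrafilterFunctional {H : Type*} [NormedAddCommGroup H] [InnerProductSpace ℂ H]
    [CompleteSpace H] (e : HilbertBasis ℕ ℂ H) (U : Ultrafilter ℕ)
    (φ : Arens.Bidual ℂ (HSTensor H)) : Prop :=
  Tendsto (fun n : ℕ => StrongDual.toWeakDual
      (Arens.J ℂ (HSTensor H)
        (ProjTensor.tmul ℂ (HilbertSchmidt.rankOne (e n) (e n))
          (HilbertSchmidt.rankOne (e n) (e n)))))
    U (𝓝 (StrongDual.toWeakDual φ))

end HilbertSchmidt

end

/-!
Write `p n = eₙₙ ⊗ eₙₙ`, so that `φ_U` is the weak* limit of the `p n` along `U`.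

The functional `φ_U` lies in both topological centres because all its Arens products vanish. For
`b = S ⊗ T` the product `p n * b` is the tensor product of the `n`-th rows of `S` and of `T`; the
norms of the rows of a Hilbert–Schmidt operator are square-summable, so Cauchy–Schwarz gives
`∑ ‖p n * b‖ ≤ ‖b‖` on elementary tensors, hence on all of `A` by maximality of the projective norm
(`HilbertSchmidt.sum_norm_unitTensor_mul_le`). Therefore, for `ω ∈ A^*`, the functionals
`ω_{p n} = ω (p n * ·)` form a weakly unconditionally Cauchy series in `A^*`, and `ψ (ω_{p n})`
is summable for every `ψ ∈ A^{**}`. In the limit `(φ_U □ ψ) ω = lim ψ (ω_{p n}) = 0`, while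
`(φ_U ⋄ ψ) ω = ψ (b ↦ lim ω (p n * b)) = 0`
(`Arens.mem_leftTopologicalCenter_of_sum_norm_le`). Columns replace rows for products in the other
order.

The remaining assertions use functionals on `A` of the form `S ⊗ T ↦ ∑ w_{ij} S_{ij} T_{ij}` with
bounded weights `w` (`HilbertSchmidt.exists_weighted_dual`). The weights supported on the diagonal
entries with `i ≥ N` give functionals that tend to `0` pointwise on `A` as `N → ∞`, but `φ_U` is
`1` at each of them, so `φ_U` is not in `J(A)`; together with the first part this rules out strong
irregularity on either side. The weight `1_{i ≤ j}` takes at `(e_{m0} ⊗ e_{m0}) (e_{0n} ⊗ e_{0n})`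
the value `1` or `0` according to whether `m ≤ n`, so its two iterated limits differ and `A` is not
Arens regular.
-/

/-! ### Ultrafilter limits in the bidual and the topological centres -/

namespace Arens

/-- A weakly unconditionally Cauchy series is absolutely summable under every functional. -/
theorem summable_norm_apply_of_norm_sum_smul_le {E : Type*} [SeminormedAddCommGroup E]
    [NormedSpace ℂ E] {y : ℕ → E} {C : ℝ}
    (hy : ∀ (F : Finset ℕ) (θ : ℕ → ℂ), (∀ n, ‖θ n‖ ≤ 1) → ‖∑ n ∈ F, θ n • y n‖ ≤ C)
    (ψ : StrongDual ℂ E) : Summable fun n => ‖ψ (y n)‖ := by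
  refine summable_of_sum_le (c := ‖ψ‖ * C) (fun _ => norm_nonneg _) fun F => ?_
  -- The phases `θ n` turn `∑ ‖ψ (y n)‖` into the value of `ψ` at one vector.
  let θ : ℕ → ℂ := fun n => (‖ψ (y n)‖ : ℂ) / ψ (y n)
  have hθ : ∀ n, ‖θ n‖ ≤ 1 := fun n => by
    simp only [θ, norm_div, Complex.norm_real, norm_norm]
    exact div_self_le_one _
  have hψ : ψ (∑ n ∈ F, θ n • y n) = ((∑ n ∈ F, ‖ψ (y n)‖ : ℝ) : ℂ) := by
    rw [map_sum, Complex.ofReal_sum]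
    refine Finset.sum_congr rfl fun n _ => ?_
    rw [map_smul, smul_eq_mul]
    by_cases h : ψ (y n) = 0
    · simp [h]
    · exact div_mul_cancel₀ _ h
  calc ∑ n ∈ F, ‖ψ (y n)‖ = ‖ψ (∑ n ∈ F, θ n • y n)‖ := by
        rw [hψ, Complex.norm_real, Real.norm_of_nonneg (Finset.sum_nonneg fun _ _ => norm_nonneg _)]
    _ ≤ ‖ψ‖ * ‖∑ n ∈ F, θ n • y n‖ := ψ.le_opNorm _
    _ ≤ ‖ψ‖ * C := by gcongr; exact hy F θ hθ

theorem tendsto_zero_of_sum_norm_le {E : Type*} [SeminormedAddCommGroup E]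
    {U : Filter ℕ} (hU : U ≤ cofinite) {y : ℕ → E} {D : ℝ} (hy : ∀ F : Finset ℕ, ∑ n ∈ F, ‖y n‖ ≤ D) :
    Tendsto y U (𝓝 0) :=
  tendsto_zero_iff_norm_tendsto_zero.2 <|
    (summable_of_sum_le (fun _ => norm_nonneg _) hy).tendsto_cofinite_zero.mono_left hU

section

variable {A : Type*} [NonUnitalNormedRing A] [NormedSpace ℂ A]

theorem tendsto_toWeakDual_J_iff {x : ℕ → A} {l : Filter ℕ} {φ : Bidual ℂ A} :
    Tendsto (fun n => StrongDual.toWeakDual (J ℂ A (x n))) l (𝓝 (StrongDual.toWeakDual φ)) ↔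
      ∀ ω : Dual ℂ A, Tendsto (fun n => ω (x n)) l (𝓝 (φ ω)) :=
  tendsto_iff_forall_eval_tendsto_topDualPairing

/-- Banach–Alaoglu: a bounded sequence in `A` has a weak* limit in `A^{**}` along any
ultrafilter. -/
theorem exists_tendsto_ultrafilter {x : ℕ → A} {C : ℝ} (hx : ∀ n, ‖x n‖ ≤ C) (U : Ultrafilter ℕ) :
    ∃ φ : Bidual ℂ A, ∀ ω : Dual ℂ A, Tendsto (fun n => ω (x n)) U (𝓝 (φ ω)) := by
  have hK := WeakDual.isCompact_closedBall (𝕜 := ℂ) (0 : StrongDual ℂ (StrongDual ℂ A)) C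
  have hU : (U.map fun n => StrongDual.toWeakDual (J ℂ A (x n)) : Filter _) ≤
      𝓟 (WeakDual.toStrongDual ⁻¹' Metric.closedBall (0 : Bidual ℂ A) C) := by
    rw [le_principal_iff, Ultrafilter.coe_map, mem_map]
    refine Filter.univ_mem' fun n => ?_
    exact (dist_zero_right (J ℂ A (x n))).trans_le
      ((NormedSpace.double_dual_bound ℂ A (x n)).trans (hx n))
  obtain ⟨φ, -, hφ⟩ := hK.ultrafilter_le_nhds _ hU
  exact ⟨WeakDual.toStrongDual φ, tendsto_toWeakDual_J_iff.1 hφ⟩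

variable [IsScalarTower ℂ A A] [SMulCommClass ℂ A A]

/-- Grothendieck's double limit criterion, in the direction that yields irregularity, for
triangular arrays: the iterated limits of `ω (aₘ bₙ)` are `1` and `0`. -/
theorem not_isArensRegular_of_triangular {a b : ℕ → A} {C D : ℝ} (ha : ∀ m, ‖a m‖ ≤ C)
    (hb : ∀ n, ‖b n‖ ≤ D) (ω : Dual ℂ A) (hω : ∀ m n, ω (a m * b n) = if m ≤ n then 1 else 0) :
    ¬ IsArensRegular ℂ A := by
  intro h
  have hU : (hyperfilter ℕ : Filter ℕ) ≤ atTop := Nat.cofinite_eq_atTop ▸ hyperfilter_le_cofinite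
  obtain ⟨f, hf⟩ := exists_tendsto_ultrafilter ha (hyperfilter ℕ)
  obtain ⟨g, hg⟩ := exists_tendsto_ultrafilter hb (hyperfilter ℕ)
  have h₁ : box f g ω = 1 := by
    have hm : ∀ m, g (dualL ℂ A ω (a m)) = 1 := fun m =>
      tendsto_nhds_unique (hg (dualL ℂ A ω (a m))) <| tendsto_const_nhds.congr' <|
        hU <| (eventually_ge_atTop m).mono fun n hn => by simp [hω, hn]
    exact tendsto_nhds_unique (hf (g.comp (dualL ℂ A ω)))
      (tendsto_const_nhds.congr fun m => (hm m).symm)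
  have h₀ : diamond f g ω = 0 := by
    have hn : ∀ n, f (dualR ℂ A ω (b n)) = 0 := fun n =>
      tendsto_nhds_unique (hf (dualR ℂ A ω (b n))) <| tendsto_const_nhds.congr' <|
        hU <| (eventually_gt_atTop n).mono fun m hm => by simp [hω, not_le.2 hm]
    exact tendsto_nhds_unique (hg (f.comp (dualR ℂ A ω)))
      (tendsto_const_nhds.congr fun n => (hn n).symm)
  rw [h, h₀] at h₁
  exact zero_ne_one h₁

theorem J_mem_leftTopologicalCenter (a : A) : J ℂ A a ∈ leftTopologicalCenter ℂ A := by
  intro ψ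
  ext ω
  rw [box_apply, diamond_apply, NormedSpace.dual_def]
  refine congrArg ψ (ContinuousLinearMap.ext fun b => ?_)
  exact (dualL_apply ω a b).trans (dualR_apply ω b a).symm

theorem J_mem_rightTopologicalCenter (a : A) : J ℂ A a ∈ rightTopologicalCenter ℂ A := by
  intro ψ
  ext ω
  rw [box_apply, diamond_apply, NormedSpace.dual_def]
  refine congrArg ψ (ContinuousLinearMap.ext fun b => ?_)
  exact (dualL_apply ω b a).trans (dualR_apply ω a b).symm

theorem add_mem_leftTopologicalCenter {φ φ' : Bidual ℂ A} (h : φ ∈ leftTopologicalCenter ℂ A)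
    (h' : φ' ∈ leftTopologicalCenter ℂ A) : φ + φ' ∈ leftTopologicalCenter ℂ A := by
  intro ψ
  have e : diamond (φ + φ') ψ = diamond φ ψ + diamond φ' ψ := by
    ext ω
    simp only [diamond_apply, ContinuousLinearMap.add_comp, add_apply, map_add]
  rw [e, ← h ψ, ← h' ψ]
  rfl

theorem add_mem_rightTopologicalCenter {φ φ' : Bidual ℂ A} (h : φ ∈ rightTopologicalCenter ℂ A)
    (h' : φ' ∈ rightTopologicalCenter ℂ A) : φ + φ' ∈ rightTopologicalCenter ℂ A := by
  intro ψ
  have e : box ψ (φ + φ') = box ψ φ + box ψ φ' := by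
    ext ω
    simp only [box_apply, ContinuousLinearMap.add_comp, add_apply, map_add]
  rw [e, h ψ, h' ψ]
  rfl

variable {p : ℕ → A} {U : Filter ℕ} {φ : Bidual ℂ A} {C : ℝ}

/-- If `∑ ‖pₙ b‖ ≤ C ‖b‖` for all `b`, then a weak* limit `φ` of `pₙ` satisfies
`φ □ ψ = 0 = φ ⋄ ψ`: the functionals `ω_{pₙ}` form a weakly unconditionally Cauchy series, so they
tend to `0` weakly, and not only pointwise on `A`. -/
theorem mem_leftTopologicalCenter_of_sum_norm_le [U.NeBot] (hU : U ≤ cofinite)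
    (hφ : ∀ ω : Dual ℂ A, Tendsto (fun n => ω (p n)) U (𝓝 (φ ω)))
    (hp : ∀ (F : Finset ℕ) (b : A), ∑ n ∈ F, ‖p n * b‖ ≤ C * ‖b‖) :
    φ ∈ leftTopologicalCenter ℂ A := by
  intro ψ
  ext ω
  have h₁ : box φ ψ ω = 0 := by
    refine tendsto_nhds_unique (hφ (ψ.comp (dualL ℂ A ω))) ?_
    have hs := summable_norm_apply_of_norm_sum_smul_le (y := fun n => dualL ℂ A ω (p n))
      (C := ‖ω‖ * |C|) (fun F θ hθ => by
        refine ContinuousLinearMap.opNorm_le_bound _ (by positivity) fun b => ?_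
        have e : (∑ n ∈ F, θ n • dualL ℂ A ω (p n)) b = ω (∑ n ∈ F, θ n • (p n * b)) := by
          simp
        rw [e, mul_assoc]
        refine (ω.le_opNorm _).trans (mul_le_mul_of_nonneg_left ?_ (norm_nonneg _))
        refine (norm_sum_le _ _).trans ((Finset.sum_le_sum fun n _ => ?_).trans
          ((hp F b).trans (by gcongr; exact le_abs_self C)))
        rw [norm_smul]
        exact mul_le_of_le_one_left (norm_nonneg _) (hθ n)) ψ
    exact tendsto_zero_iff_norm_tendsto_zero.2 (hs.tendsto_cofinite_zero.mono_left hU)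
  have h₂ : φ.comp (dualR ℂ A ω) = 0 := by
    ext b
    refine tendsto_nhds_unique (hφ (dualR ℂ A ω b)) ?_
    simpa [Function.comp_def] using (ω.continuous.tendsto 0).comp
      (tendsto_zero_of_sum_norm_le hU fun F => hp F b)
  rw [h₁, diamond_apply, h₂, map_zero]

/-- The mirror image of `mem_leftTopologicalCenter_of_sum_norm_le`. -/
theorem mem_rightTopologicalCenter_of_sum_norm_le [U.NeBot] (hU : U ≤ cofinite)
    (hφ : ∀ ω : Dual ℂ A, Tendsto (fun n => ω (p n)) U (𝓝 (φ ω)))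
    (hp : ∀ (F : Finset ℕ) (b : A), ∑ n ∈ F, ‖b * p n‖ ≤ C * ‖b‖) :
    φ ∈ rightTopologicalCenter ℂ A := by
  intro ψ
  ext ω
  have h₁ : diamond ψ φ ω = 0 := by
    refine tendsto_nhds_unique (hφ (ψ.comp (dualR ℂ A ω))) ?_
    have hs := summable_norm_apply_of_norm_sum_smul_le (y := fun n => dualR ℂ A ω (p n))
      (C := ‖ω‖ * |C|) (fun F θ hθ => by
        refine ContinuousLinearMap.opNorm_le_bound _ (by positivity) fun b => ?_
        have e : (∑ n ∈ F, θ n • dualR ℂ A ω (p n)) b = ω (∑ n ∈ F, θ n • (b * p n)) := by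
          simp
        rw [e, mul_assoc]
        refine (ω.le_opNorm _).trans (mul_le_mul_of_nonneg_left ?_ (norm_nonneg _))
        refine (norm_sum_le _ _).trans ((Finset.sum_le_sum fun n _ => ?_).trans
          ((hp F b).trans (by gcongr; exact le_abs_self C)))
        rw [norm_smul]
        exact mul_le_of_le_one_left (norm_nonneg _) (hθ n)) ψ
    exact tendsto_zero_iff_norm_tendsto_zero.2 (hs.tendsto_cofinite_zero.mono_left hU)
  have h₂ : φ.comp (dualL ℂ A ω) = 0 := by
    ext b
    refine tendsto_nhds_unique (hφ (dualL ℂ A ω b)) ?_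
    simpa [Function.comp_def] using (ω.continuous.tendsto 0).comp
      (tendsto_zero_of_sum_norm_le hU fun F => hp F b)
  rw [h₁, box_apply, h₂, map_zero]

end

end Arens

/-! ### Estimates and functionals on the projective tensor product -/

section Projective

variable {𝕜 : Type*} [NontriviallyNormedField 𝕜]
  {A : Type*} [NonUnitalNormedRing A] [NormedSpace 𝕜 A] [IsScalarTower 𝕜 A A]
  [SMulCommClass 𝕜 A A]
  {B : Type*} [NonUnitalNormedRing B] [NormedSpace 𝕜 B] [IsScalarTower 𝕜 B B]
  [SMulCommClass 𝕜 B B]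

/-- The projective norm is the largest one that is at most `‖a‖ ‖b‖` on elementary tensors. -/
theorem AlgTensor.le_mul_norm_of_subadditive {q : AlgTensor 𝕜 A B → ℝ} {C : ℝ} (hC : 0 ≤ C)
    (h0 : q 0 = 0) (hadd : ∀ u v, q (u + v) ≤ q u + q v)
    (hq : ∀ a b, q (tmul 𝕜 a b) ≤ C * (‖a‖ * ‖b‖)) (u : AlgTensor 𝕜 A B) : q u ≤ C * ‖u‖ := by
  have key : ∀ r ∈ repValues u, q u ≤ C * r := by
    rintro r ⟨n, a, b, rfl, rfl⟩
    rw [Finset.mul_sum]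
    exact (Finset.le_sum_of_subadditive q h0.le hadd _ _).trans
      (Finset.sum_le_sum fun i _ => hq _ _)
  refine le_of_forall_pos_le_add fun ε hε => ?_
  obtain ⟨r, hr, hr'⟩ := exists_mem_lt u (div_pos hε (by positivity : 0 < C + 1))
  calc q u ≤ C * r := key r hr
    _ ≤ C * (‖u‖ + ε / (C + 1)) := by gcongr
    _ = C * ‖u‖ + C / (C + 1) * ε := by ring
    _ ≤ C * ‖u‖ + ε := by
      gcongr
      exact mul_le_of_le_one_left hε.le ((div_le_one (by positivity)).2 (by linarith))

namespace ProjTensor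

theorem norm_tmul_le (a : A) (b : B) : ‖tmul 𝕜 a b‖ ≤ ‖a‖ * ‖b‖ :=
  (norm_ofAlg 𝕜 _).trans_le (AlgTensor.norm_tmul_le a b)

theorem le_mul_norm_of_subadditive {q : ProjTensor 𝕜 A B → ℝ} {C : ℝ} (hC : 0 ≤ C)
    (hcont : Continuous q) (h0 : q 0 = 0) (hadd : ∀ x y, q (x + y) ≤ q x + q y)
    (hq : ∀ a b, q (tmul 𝕜 a b) ≤ C * (‖a‖ * ‖b‖)) (x : ProjTensor 𝕜 A B) : q x ≤ C * ‖x‖ :=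
  induction_on₁ (p := fun x => q x ≤ C * ‖x‖) x
    (isClosed_le hcont (by fun_prop)) fun u => by
      rw [norm_ofAlg]
      exact AlgTensor.le_mul_norm_of_subadditive (q := fun u => q (ofAlg 𝕜 u)) hC (by simp [h0])
        (fun u v => by simpa using hadd _ _) hq u

/-- A bounded bilinear form on `A × B` is a functional on `A ⊗^γ B`. -/
theorem exists_dual_of_bilinear [CompleteSpace 𝕜] (β : A →ₗ[𝕜] B →ₗ[𝕜] 𝕜) {C : ℝ} (hC : 0 ≤ C)
    (hβ : ∀ a b, ‖β a b‖ ≤ C * (‖a‖ * ‖b‖)) :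
    ∃ ω : StrongDual 𝕜 (ProjTensor 𝕜 A B), (∀ a b, ω (tmul 𝕜 a b) = β a b) ∧
      ∀ x, ‖ω x‖ ≤ C * ‖x‖ := by
  let l : AlgTensor 𝕜 A B →ₗ[𝕜] 𝕜 := TensorProduct.lift β
  have hl : ∀ a b, l (AlgTensor.tmul 𝕜 a b) = β a b := fun a b => TensorProduct.lift.tmul a b
  have hbound : ∀ u, ‖l u‖ ≤ C * ‖(ofAlg 𝕜 : _ →L[𝕜] ProjTensor 𝕜 A B).toLinearMap u‖ := fun u => by
    refine (AlgTensor.le_mul_norm_of_subadditive (q := fun u => ‖l u‖) hC (by simp)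
      (fun u v => ?_) (fun a b => ?_) u).trans_eq (congrArg _ (norm_ofAlg 𝕜 u).symm)
    · rw [map_add]; exact norm_add_le _ _
    · rw [hl]; exact hβ a b
  have hd : DenseRange (ofAlg 𝕜 : _ →L[𝕜] ProjTensor 𝕜 A B).toLinearMap :=
    (isDenseInducing_ofAlg 𝕜).dense
  exact ⟨l.extendOfNorm (ofAlg 𝕜 : _ →L[𝕜] ProjTensor 𝕜 A B).toLinearMap,
    fun a b => (LinearMap.extendOfNorm_eq hd ⟨C, hbound⟩ _).trans (hl a b),
    LinearMap.norm_extendOfNorm_apply_le hd C hbound⟩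

/-- A bounded sequence of functionals tends to `0` pointwise if it does so on elementary
tensors. -/
theorem tendsto_zero_of_tmul {ω : ℕ → StrongDual 𝕜 (ProjTensor 𝕜 A B)} {C : ℝ} (hC : 0 ≤ C)
    (hω : ∀ n x, ‖ω n x‖ ≤ C * ‖x‖)
    (h : ∀ a b, Tendsto (fun n => ω n (tmul 𝕜 a b)) atTop (𝓝 0)) (x : ProjTensor 𝕜 A B) :
    Tendsto (fun n => ω n x) atTop (𝓝 0) := by
  have halg : ∀ u : AlgTensor 𝕜 A B, Tendsto (fun n => ω n (ofAlg 𝕜 u)) atTop (𝓝 0) := fun u => by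
    obtain ⟨-, n, a, b, rfl, -⟩ := AlgTensor.nonempty_repValues u
    simp only [map_sum]
    rw [← Finset.sum_const_zero (s := (Finset.univ : Finset (Fin n)))]
    exact tendsto_finsetSum Finset.univ fun i _ => h (a i) (b i)
  rw [Metric.tendsto_atTop]
  intro ε hε
  obtain ⟨u, hu⟩ := (isDenseInducing_ofAlg (A := A) (B := B) 𝕜).dense.exists_dist_lt x
    (div_pos (half_pos hε) (by positivity : 0 < C + 1))
  obtain ⟨N, hN⟩ := Metric.tendsto_atTop.1 (halg u) (ε / 2) (half_pos hε)
  refine ⟨N, fun n hn => ?_⟩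
  have h₁ := hN n hn
  rw [dist_zero_right] at h₁ ⊢
  have h₂ : ‖ω n (x - ofAlg 𝕜 u)‖ ≤ ε / 2 := by
    refine (hω n _).trans ?_
    rw [dist_eq_norm, lt_div_iff₀ (by positivity)] at hu
    nlinarith [norm_nonneg (x - ofAlg 𝕜 u)]
  calc ‖ω n x‖ = ‖ω n (x - ofAlg 𝕜 u) + ω n (ofAlg 𝕜 u)‖ := by rw [← map_add, sub_add_cancel]
    _ ≤ _ := norm_add_le _ _
    _ < ε := by linarith

end ProjTensor

end Projective

/-- The Cauchy–Schwarz inequality, for partial sums. -/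
theorem sum_mul_le_mul_of_hasSum_sq {ι : Type*} {f g : ι → ℝ} {a b : ℝ} (ha : 0 ≤ a) (hb : 0 ≤ b)
    (hf : HasSum (fun i => f i ^ 2) (a ^ 2)) (hg : HasSum (fun i => g i ^ 2) (b ^ 2))
    (F : Finset ι) : ∑ i ∈ F, f i * g i ≤ a * b := by
  refine (Real.sum_mul_le_sqrt_mul_sqrt F f g).trans ?_
  gcongr
  · exact Real.sqrt_le_iff.2 ⟨ha, sum_le_hasSum F (fun _ _ => sq_nonneg _) hf⟩
  · exact Real.sqrt_le_iff.2 ⟨hb, sum_le_hasSum F (fun _ _ => sq_nonneg _) hg⟩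

/-! ### Matrix coefficients of Hilbert–Schmidt operators -/

namespace HilbertSchmidt

variable {H : Type*} [NormedAddCommGroup H] [InnerProductSpace ℂ H] [CompleteSpace H]

theorem norm_rankOne (x y : H) : ‖rankOne x y‖ = ‖x‖ * ‖y‖ := by
  have h := hasSum_norm_sq (hsBasis H) (rankOne x y)
  have h' := (parseval (hsBasis H) y).mul_left (‖x‖ ^ 2)
  rw [← sq_eq_sq₀ (norm_nonneg _) (by positivity), mul_pow]
  refine h.unique (h'.congr_fun fun i => ?_)
  rw [toOp_rankOne, norm_smul, mul_pow, norm_inner_symm, mul_comm]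

variable (e : HilbertBasis ℕ ℂ H)

/-- The matrix coefficient `⟨T e_j, e_i⟩` at `k = (i, j)`. -/
noncomputable def coeff (k : ℕ × ℕ) : HilbertSchmidt H →ₗ[ℂ] ℂ where
  toFun T := inner ℂ (e k.1) (toOp T (e k.2))
  map_add' S T := by simp
  map_smul' c T := by simp

theorem coeff_apply (k : ℕ × ℕ) (T : HilbertSchmidt H) :
    coeff e k T = inner ℂ (e k.1) (toOp T (e k.2)) := rfl

theorem hasSum_norm_coeff_sq (T : HilbertSchmidt H) :
    HasSum (fun k => ‖coeff e k T‖ ^ 2) (‖T‖ ^ 2) := by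
  have h : ∑' k, ‖coeff e k T‖ₑ ^ 2 = ENNReal.ofReal (‖T‖ ^ 2) := by
    have hp : ∀ j, ∑' i, ‖coeff e (i, j) T‖ₑ ^ 2 = ‖toOp T (e j)‖ₑ ^ 2 := fun j => by
      simp only [coeff_apply]
      exact parseval_enorm e (toOp T (e j))
    rw [enorm_sq e T, ENNReal.tsum_prod', ENNReal.tsum_comm]
    exact tsum_congr hp
  have hs : Summable fun k => ‖coeff e k T‖ ^ 2 :=
    (summable_sq_iff fun k => coeff e k T).2 (h ▸ ENNReal.ofReal_ne_top)
  rw [← ofReal_tsum_sq (fun k => coeff e k T) hs, ENNReal.ofReal_eq_ofReal_iff (tsum_nonneg fun _ => by positivity)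
    (by positivity)] at h
  exact h ▸ hs.hasSum

theorem coeff_rankOne (m n : ℕ) (k : ℕ × ℕ) :
    coeff e k (rankOne (e m) (e n)) = if k = (m, n) then 1 else 0 := by
  obtain ⟨i, j⟩ := k
  have h := orthonormal_iff_ite.1 e.orthonormal
  rw [coeff_apply, toOp_rankOne, inner_smul_right, h, h]
  by_cases hi : i = m <;> by_cases hj : j = n <;> simp [hi, hj, Ne.symm]

theorem rankOne_mul_rankOne (m k n : ℕ) :
    rankOne (e m) (e k) * rankOne (e k) (e n) = rankOne (e m) (e n) := by
  apply toOp_injective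
  ext ξ
  simp [toOp_mul, toOp_rankOne, e.orthonormal.1]

theorem hasSum_norm_rankOne_mul_sq (T : HilbertSchmidt H) :
    HasSum (fun n => ‖rankOne (e n) (e n) * T‖ ^ 2) (‖T‖ ^ 2) := by
  refine (hasSum_norm_coeff_sq e T).prod_fiberwise fun n => ?_
  refine (hasSum_norm_sq e (rankOne (e n) (e n) * T)).congr_fun fun j => ?_
  rw [toOp_mul, mul_apply_eq_comp, toOp_rankOne, norm_smul, e.orthonormal.1 n, mul_one]
  rfl

theorem hasSum_norm_mul_rankOne_sq (T : HilbertSchmidt H) :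
    HasSum (fun n => ‖T * rankOne (e n) (e n)‖ ^ 2) (‖T‖ ^ 2) := by
  refine (hasSum_norm_sq e T).congr_fun fun n => ?_
  refine (hasSum_norm_sq e (T * rankOne (e n) (e n))).unique ?_
  convert hasSum_ite_eq n (‖toOp T (e n)‖ ^ 2) using 2 with j
  rw [toOp_mul, mul_apply_eq_comp, toOp_rankOne,
    orthonormal_iff_ite.1 e.orthonormal]
  split_ifs <;> grind [one_smul, zero_smul, norm_zero]

theorem summable_coeff_mul_coeff {w : ℕ × ℕ → ℂ} (hw : ∀ k, ‖w k‖ ≤ 1) (S T : HilbertSchmidt H) :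
    (Summable fun k => ‖w k * (coeff e k S * coeff e k T)‖) ∧
      ∑' k, ‖w k * (coeff e k S * coeff e k T)‖ ≤ ‖S‖ * ‖T‖ := by
  have h : ∀ F : Finset (ℕ × ℕ), ∑ k ∈ F, ‖w k * (coeff e k S * coeff e k T)‖ ≤ ‖S‖ * ‖T‖ :=
    fun F => (Finset.sum_le_sum fun k _ => by
      rw [norm_mul, norm_mul]
      exact mul_le_of_le_one_left (by positivity) (hw k)).trans
        (sum_mul_le_mul_of_hasSum_sq (norm_nonneg S) (norm_nonneg T) (hasSum_norm_coeff_sq e S)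
          (hasSum_norm_coeff_sq e T) F)
  exact ⟨summable_of_sum_le (fun _ => norm_nonneg _) h,
    (summable_of_sum_le (fun _ => norm_nonneg _) h).tsum_le_of_sum_le h⟩

/-- The functional of norm at most one on `S₂(H) ⊗^γ S₂(H)` given by the weighted bilinear form
`(S, T) ↦ ∑ w_{ij} S_{ij} T_{ij}`, for weights bounded by one. -/
theorem exists_weighted_dual {w : ℕ × ℕ → ℂ} (hw : ∀ k, ‖w k‖ ≤ 1) :
    ∃ ω : StrongDual ℂ (HSTensor H),
      (∀ S T, ω (ProjTensor.tmul ℂ S T) = ∑' k, w k * (coeff e k S * coeff e k T)) ∧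
        ∀ x, ‖ω x‖ ≤ 1 * ‖x‖ := by
  have hs := fun S T => (summable_coeff_mul_coeff e hw S T).1.of_norm
  let β : HilbertSchmidt H →ₗ[ℂ] HilbertSchmidt H →ₗ[ℂ] ℂ :=
    LinearMap.mk₂ ℂ (fun S T => ∑' k, w k * (coeff e k S * coeff e k T))
      (fun S S' T => by
        rw [← (hs S T).tsum_add (hs S' T)]
        exact tsum_congr fun k => by rw [map_add]; ring)
      (fun c S T => by
        rw [smul_eq_mul, ← tsum_mul_left]
        exact tsum_congr fun k => by rw [map_smul, smul_eq_mul]; ring)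
      (fun S T T' => by
        rw [← (hs S T).tsum_add (hs S T')]
        exact tsum_congr fun k => by rw [map_add]; ring)
      (fun c S T => by
        rw [smul_eq_mul, ← tsum_mul_left]
        exact tsum_congr fun k => by rw [map_smul, smul_eq_mul]; ring)
  refine ProjTensor.exists_dual_of_bilinear β zero_le_one fun S T => ?_
  rw [one_mul]
  exact (norm_tsum_le_tsum_norm (summable_coeff_mul_coeff e hw S T).1).trans
    (summable_coeff_mul_coeff e hw S T).2

/-- The matrix unit `e_{mn}`, tensored with itself. -/
noncomputable def unitTensor (m n : ℕ) : HSTensor H :=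
  ProjTensor.tmul ℂ (rankOne (e m) (e n)) (rankOne (e m) (e n))

theorem norm_unitTensor_le (m n : ℕ) : ‖unitTensor e m n‖ ≤ 1 := by
  refine (ProjTensor.norm_tmul_le _ _).trans_eq ?_
  simp [norm_rankOne, e.orthonormal.1]

theorem unitTensor_mul_unitTensor (m k n : ℕ) :
    unitTensor e m k * unitTensor e k n = unitTensor e m n := by
  rw [unitTensor, unitTensor, ProjTensor.tmul_mul_tmul, rankOne_mul_rankOne]
  rfl

theorem tsum_weight_unitTensor (w : ℕ × ℕ → ℂ) (m n : ℕ) :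
    ∑' k, w k * (coeff e k (rankOne (e m) (e n)) * coeff e k (rankOne (e m) (e n))) = w (m, n) := by
  rw [tsum_eq_single (m, n) fun k hk => by simp [coeff_rankOne, hk]]
  simp [coeff_rankOne]

theorem sum_norm_unitTensor_mul_le (F : Finset ℕ) (x : HSTensor H) :
    ∑ n ∈ F, ‖unitTensor e n n * x‖ ≤ 1 * ‖x‖ := by
  refine ProjTensor.le_mul_norm_of_subadditive (q := fun x => ∑ n ∈ F, ‖unitTensor e n n * x‖)
    zero_le_one (by fun_prop) (by simp) (fun x y => ?_) (fun S T => ?_) x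
  · rw [← Finset.sum_add_distrib]
    exact Finset.sum_le_sum fun n _ => by rw [mul_add]; exact norm_add_le _ _
  · rw [one_mul]
    refine (Finset.sum_le_sum fun n _ => ?_).trans (sum_mul_le_mul_of_hasSum_sq (norm_nonneg S)
      (norm_nonneg T) (hasSum_norm_rankOne_mul_sq e S) (hasSum_norm_rankOne_mul_sq e T) F)
    rw [unitTensor, ProjTensor.tmul_mul_tmul]
    exact ProjTensor.norm_tmul_le _ _

theorem sum_norm_mul_unitTensor_le (F : Finset ℕ) (x : HSTensor H) :
    ∑ n ∈ F, ‖x * unitTensor e n n‖ ≤ 1 * ‖x‖ := by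
  refine ProjTensor.le_mul_norm_of_subadditive (q := fun x => ∑ n ∈ F, ‖x * unitTensor e n n‖)
    zero_le_one (by fun_prop) (by simp) (fun x y => ?_) (fun S T => ?_) x
  · rw [← Finset.sum_add_distrib]
    exact Finset.sum_le_sum fun n _ => by rw [add_mul]; exact norm_add_le _ _
  · rw [one_mul]
    refine (Finset.sum_le_sum fun n _ => ?_).trans (sum_mul_le_mul_of_hasSum_sq (norm_nonneg S)
      (norm_nonneg T) (hasSum_norm_mul_rankOne_sq e S) (hasSum_norm_mul_rankOne_sq e T) F)
    rw [unitTensor, ProjTensor.tmul_mul_tmul]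
    exact ProjTensor.norm_tmul_le _ _

/-! ### Irregularity, and the functional `φ_U` -/

theorem not_isArensRegular (e : HilbertBasis ℕ ℂ H) : ¬ Arens.IsArensRegular ℂ (HSTensor H) := by
  obtain ⟨ω, hω, -⟩ := exists_weighted_dual e (w := fun k => if k.1 ≤ k.2 then 1 else 0)
    fun k => by split_ifs <;> simp
  refine Arens.not_isArensRegular_of_triangular (fun m => norm_unitTensor_le e m 0)
    (fun n => norm_unitTensor_le e 0 n) ω fun m n => ?_
  rw [unitTensor_mul_unitTensor, unitTensor, hω, tsum_weight_unitTensor]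

variable {e} {U : Ultrafilter ℕ} {φ : Arens.Bidual ℂ (HSTensor H)}

theorem isUltrafilterFunctional_iff : IsUltrafilterFunctional e U φ ↔
    ∀ ω : StrongDual ℂ (HSTensor H), Tendsto (fun n => ω (unitTensor e n n)) U (𝓝 (φ ω)) :=
  Arens.tendsto_toWeakDual_J_iff

theorem existsUnique_isUltrafilterFunctional (e : HilbertBasis ℕ ℂ H) (U : Ultrafilter ℕ) :
    ∃! φ, IsUltrafilterFunctional e U φ := by
  obtain ⟨φ, hφ⟩ := Arens.exists_tendsto_ultrafilter (fun n => norm_unitTensor_le e n n) U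
  refine ⟨φ, isUltrafilterFunctional_iff.2 hφ, fun φ' hφ' => ?_⟩
  ext ω
  exact tendsto_nhds_unique (isUltrafilterFunctional_iff.1 hφ' ω) (hφ ω)

/-- `φ_U` takes the value `1` at each of the forms `(S, T) ↦ ∑_{n ≥ N} S_{nn} T_{nn}`, which tend
to `0` pointwise on `A`. -/
theorem notMem_range_J (hU : (U : Filter ℕ) ≤ cofinite) (hφ : IsUltrafilterFunctional e U φ) :
    φ ∉ Set.range (Arens.J ℂ (HSTensor H)) := by
  rintro ⟨a, rfl⟩
  rw [isUltrafilterFunctional_iff] at hφ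
  choose ω hω hω' using fun N : ℕ => exists_weighted_dual e
    (w := fun k => if k.1 = k.2 ∧ N ≤ k.1 then 1 else 0) fun k => by split_ifs <;> simp
  have h₁ : ∀ N, ω N a = 1 := fun N =>
    tendsto_nhds_unique (hφ (ω N)) <| tendsto_const_nhds.congr' <|
      (hU.trans Nat.cofinite_eq_atTop.le) <| (eventually_ge_atTop N).mono fun n hn => by
        change 1 = ω N (unitTensor e n n)
        rw [unitTensor, hω, tsum_weight_unitTensor]
        simp [hn]
  have h₀ : Tendsto (fun N => ω N a) atTop (𝓝 0) := by
    refine ProjTensor.tendsto_zero_of_tmul zero_le_one hω' (fun S T => ?_) a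
    simp only [hω]
    have hs := (summable_coeff_mul_coeff e (w := fun _ => 1) (by simp) S T).1
    rw [← tsum_zero (β := ℕ × ℕ)]
    refine tendsto_tsum_of_dominated_convergence hs (fun k => ?_) (.of_forall fun N k => ?_)
    · refine tendsto_const_nhds.congr' ((eventually_gt_atTop k.1).mono fun N hN => ?_)
      simp [not_le.2 hN]
    · rw [norm_mul, norm_mul (1 : ℂ)]
      gcongr
      split_ifs <;> simp
  simp only [h₁] at h₀
  exact one_ne_zero (tendsto_nhds_unique tendsto_const_nhds h₀)

theorem mem_leftTopologicalCenter (hU : (U : Filter ℕ) ≤ cofinite)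
    (hφ : IsUltrafilterFunctional e U φ) :
    φ ∈ Arens.leftTopologicalCenter ℂ (HSTensor H) :=
  Arens.mem_leftTopologicalCenter_of_sum_norm_le hU (isUltrafilterFunctional_iff.1 hφ)
    (sum_norm_unitTensor_mul_le e)

theorem mem_rightTopologicalCenter (hU : (U : Filter ℕ) ≤ cofinite)
    (hφ : IsUltrafilterFunctional e U φ) :
    φ ∈ Arens.rightTopologicalCenter ℂ (HSTensor H) :=
  Arens.mem_rightTopologicalCenter_of_sum_norm_le hU (isUltrafilterFunctional_iff.1 hφ)
    (sum_norm_mul_unitTensor_le e)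

end HilbertSchmidt

/-! ### Orthonormal bases of separable spaces -/

theorem Orthonormal.countable_of_separableSpace {H ι : Type*} [NormedAddCommGroup H]
    [InnerProductSpace ℂ H] [TopologicalSpace.SeparableSpace H] {v : ι → H}
    (hv : Orthonormal ℂ v) : Countable ι := by
  rw [← Set.countable_univ_iff]
  -- Distinct members of an orthonormal family are at distance `√2`, so the balls are disjoint.
  refine Set.PairwiseDisjoint.countable_of_isOpen (s := fun i => Metric.ball (v i) (1 / 2))
    (fun i _ j _ hij => ?_) (fun _ _ => Metric.isOpen_ball) fun i _ => ⟨v i, by simp⟩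
  refine Metric.ball_disjoint_ball ?_
  have h : ‖v i - v j‖ ^ 2 = 2 := by
    rw [@norm_sub_sq ℂ, hv.1, hv.1, hv.2 hij]
    norm_num
  rw [dist_eq_norm]
  nlinarith [norm_nonneg (v i - v j)]

theorem exists_hilbertBasis_nat (H : Type*) [NormedAddCommGroup H] [InnerProductSpace ℂ H]
    [CompleteSpace H] [TopologicalSpace.SeparableSpace H] (hH : ¬ FiniteDimensional ℂ H) :
    Nonempty (HilbertBasis ℕ ℂ H) := by
  obtain ⟨w, b, -⟩ := exists_hilbertBasis ℂ H
  have : Countable w := b.orthonormal.countable_of_separableSpace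
  have : Infinite w := by
    by_contra hw
    have := not_infinite_iff_finite.1 hw
    have := Fintype.ofFinite w
    exact hH b.toOrthonormalBasis.toBasis.finiteDimensional_of_finite
  obtain ⟨σ⟩ := nonempty_equiv_of_countable (α := ℕ) (β := w)
  refine ⟨HilbertBasis.mk (b.orthonormal.comp σ σ.injective) ?_⟩
  rw [σ.surjective.range_comp, b.dense_span]

theorem theorem3p5 (H : Type*) [NormedAddCommGroup H] [InnerProductSpace ℂ H] [CompleteSpace H]
    [TopologicalSpace.SeparableSpace H] (hH : ¬ FiniteDimensional ℂ H) :
    ¬ Arens.IsArensRegular ℂ (HSTensor H) ∧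
    ¬ Arens.IsStronglyArensIrregular ℂ (HSTensor H) ∧
    ¬ Arens.IsLeftStronglyArensIrregular ℂ (HSTensor H) ∧
    ¬ Arens.IsRightStronglyArensIrregular ℂ (HSTensor H) ∧
    ∀ (e : HilbertBasis ℕ ℂ H) (U : Ultrafilter ℕ), (∀ n : ℕ, U ≠ pure n) →
      (∃! φ : Arens.Bidual ℂ (HSTensor H),
        IsUltrafilterFunctional e U φ) ∧
      ∀ φ : Arens.Bidual ℂ (HSTensor H),
        IsUltrafilterFunctional e U φ →
          φ ∉ Set.range (Arens.J ℂ (HSTensor H)) ∧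
          ∀ a : HSTensor H,
            Arens.J ℂ (HSTensor H) a + φ ∈ Arens.leftTopologicalCenter ℂ (HSTensor H) ∧
            Arens.J ℂ (HSTensor H) a + φ ∈ Arens.rightTopologicalCenter ℂ (HSTensor H) := by
  obtain ⟨e⟩ := exists_hilbertBasis_nat H hH
  have hyper := hyperfilter_le_cofinite (α := ℕ)
  obtain ⟨φ, hφ, -⟩ := HilbertSchmidt.existsUnique_isUltrafilterFunctional e (hyperfilter ℕ)
  have hJ := HilbertSchmidt.notMem_range_J hyper hφ
  have hl : ¬ Arens.IsLeftStronglyArensIrregular ℂ (HSTensor H) := fun h =>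
    hJ (h.subset (HilbertSchmidt.mem_leftTopologicalCenter hyper hφ))
  have hr : ¬ Arens.IsRightStronglyArensIrregular ℂ (HSTensor H) := fun h =>
    hJ (h.subset (HilbertSchmidt.mem_rightTopologicalCenter hyper hφ))
  refine ⟨HilbertSchmidt.not_isArensRegular e, fun h => hl h.1, hl, hr, fun e U hU => ?_⟩
  have hU' : (U : Filter ℕ) ≤ cofinite :=
    U.le_cofinite_or_eq_pure.resolve_right fun ⟨n, hn⟩ => hU n hn
  refine ⟨HilbertSchmidt.existsUnique_isUltrafilterFunctional e U, fun φ hφ =>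
    ⟨HilbertSchmidt.notMem_range_J hU' hφ, fun a => ⟨?_, ?_⟩⟩⟩
  · exact Arens.add_mem_leftTopologicalCenter (Arens.J_mem_leftTopologicalCenter a)
      (HilbertSchmidt.mem_leftTopologicalCenter hU' hφ)
  · exact Arens.add_mem_rightTopologicalCenter (Arens.J_mem_rightTopologicalCenter a)
      (HilbertSchmidt.mem_rightTopologicalCenter hU' hφ)
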